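/- Let $0<a<4$ and let $p$ be a positive integer with $p\ge \dfrac{2(12-a)}{4-a}$. Let $X\sim\mathcal N_p(\theta,I_p)$ with unknown mean vector $\theta\in\mathbb R^p$, and write $R(\theta,\hat\theta)=\mathrm E_\theta\bigl[\|\hat\theta(X)-\theta\|^2\bigr]$ for the quadratic risk of an estimator $\hat\theta$. Then Stein's estimator $$\hat\theta_{a,p-2}(X)=\Bigl(1-\frac{p-2}{\|X\|^2+a}\Bigr)X$$ dominates the James–Stein estimator $$\hat\theta_{\mathrm{JS}}(X)=\Bigl(1-\frac{p-2}{\|X\|^2}\Bigr)X ,$$ that is, $R(\theta,\hat\theta_{a,p-2})\le R(\theta,\hat\theta_{\mathrm{JS}})$ for every $\theta\in\mathbb R^p$, with strict inequality for at least one $\theta$. -/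

import Mathlib

open MeasureTheory ProbabilityTheory
open scoped ENNReal

/-- The quadratic risk `R(θ, δ) = E_θ ‖δ(X) - θ‖²` of an estimator `δ` of the mean vector `θ`, where
`X` is `p`-variate normal with mean `θ` and identity covariance matrix. As the expectation of a
nonnegative function it takes values in `[0, ∞]`. -/
noncomputable def quadraticRisk {p : ℕ} (θ : EuclideanSpace ℝ (Fin p))
    (δ : EuclideanSpace ℝ (Fin p) → EuclideanSpace ℝ (Fin p)) : ℝ≥0∞ :=
  ∫⁻ x, ENNReal.ofReal (‖δ x - θ‖ ^ 2)
    ∂(multivariateGaussian θ (1 : Matrix (Fin p) (Fin p) ℝ))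

/-- `δ` dominates `δ'`: its risk is nowhere larger, and somewhere strictly smaller. -/
def Dominates {p : ℕ} (δ δ' : EuclideanSpace ℝ (Fin p) → EuclideanSpace ℝ (Fin p)) : Prop :=
  (∀ θ, quadraticRisk θ δ ≤ quadraticRisk θ δ') ∧ ∃ θ, quadraticRisk θ δ < quadraticRisk θ δ'

/-- The James--Stein estimator `(1 - (p - 2) / ‖x‖²) x`. (Its value at the null event `x = 0` is
immaterial; here it is `0`.) -/
noncomputable def jamesStein (p : ℕ) (x : EuclideanSpace ℝ (Fin p)) : EuclideanSpace ℝ (Fin p) :=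
  (1 - ((p : ℝ) - 2) / ‖x‖ ^ 2) • x

/-- Stein's estimator `(1 - b / (‖x‖² + a)) x`. -/
noncomputable def steinEstimator (p : ℕ) (a b : ℝ) (x : EuclideanSpace ℝ (Fin p)) :
    EuclideanSpace ℝ (Fin p) :=
  (1 - b / (‖x‖ ^ 2 + a)) • x

/-! Put S = ‖X‖². The loss difference contains ⟪X - θ, X⟫ only through the field x / (S(S + a)).
Stein's identity for that field turns the risk difference into (p-2)a E[(4S - (p-2)a) / (S(S+a)²)],
whose sign is not yet clear. Stein's identity for x / (S(S+a)²) trades the factor S for p - 6 +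
4a/(S+a) + ⟪θ, X⟫. What remains is the weight 1/(S(S+a)²) against 4⟪θ, X⟫ + 4p - 24 - (p-2)a +
16a/(S+a). The ⟪θ, X⟫ term has nonnegative mean by reflection (`integral_mul_inner_mul_exp_nonneg`),
the constant is nonnegative exactly under the hypothesis on p, and the last term is positive, so the
inequality is strict at every θ. `loss_sub_loss_eq` merges both substitutions into one pointwise
identity, and `integral_radialStein_mul_exp` supplies Stein's identity. -/

section GaussianWeight

open Module
open scoped RealInnerProductSpace

variable {E : Type*} [NormedAddCommGroup E] [InnerProductSpace ℝ E] [FiniteDimensional ℝ E]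
  [MeasurableSpace E] [BorelSpace E]

/-! ### Integrability against Gaussian weights -/

lemma integrable_exp_neg_mul_norm_sq {b : ℝ} (hb : 0 < b) :
    Integrable (fun x : E ↦ Real.exp (-b * ‖x‖ ^ 2)) := by
  have h := (GaussianFourier.integrable_cexp_neg_mul_sq_norm_add (V := E) (b := (b : ℂ))
    (by simpa using hb) 0 0).norm
  refine h.congr (.of_forall fun x ↦ ?_)
  simp only [Complex.norm_exp]
  norm_num
  norm_cast
  exact Or.inl rfl

/-- In polar coordinates the Jacobian reduces the singularity to y ^ (n - 3), which is harmless for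
n > 2. -/
lemma integrable_inv_norm_sq_mul_exp {b : ℝ} (hb : 0 < b) (hE : 2 < finrank ℝ E) :
    Integrable (fun x : E ↦ (‖x‖ ^ 2)⁻¹ * Real.exp (-b * ‖x‖ ^ 2)) := by
  have : Nontrivial E := Module.nontrivial_of_finrank_pos (R := ℝ) (by omega)
  rw [integrable_fun_norm_addHaar (volume : Measure E)
    (f := fun y ↦ (y ^ 2)⁻¹ * Real.exp (-b * y ^ 2))]
  have h := integrableOn_rpow_mul_exp_neg_mul_sq hb (s := ((finrank ℝ E - 3 : ℕ) : ℝ))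
    (by linarith [(Nat.cast_nonneg (finrank ℝ E - 3) : (0 : ℝ) ≤ _)])
  refine h.congr_fun (fun y hy ↦ ?_) measurableSet_Ioi
  have hy0 : y ≠ 0 := ne_of_gt hy
  have : finrank ℝ E - 1 = (finrank ℝ E - 3) + 2 := by omega
  simp only [Real.rpow_natCast, smul_eq_mul]
  rw [this, pow_add]
  field_simp

-- Uniformity in t provides the dominating function for differentiating under the integral at t = 1.
omit [FiniteDimensional ℝ E] [MeasurableSpace E] [BorelSpace E] in
lemma exp_neg_norm_smul_sub_sq_le {t : ℝ} (ht : 1 / 2 ≤ t) (θ x : E) :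
    Real.exp (-‖t • x - θ‖ ^ 2 / 2) ≤
      Real.exp (‖θ‖ ^ 2 / 2) * Real.exp (-(1 / 16) * ‖x‖ ^ 2) := by
  rw [← Real.exp_add]
  gcongr
  have h1 : ‖t • x‖ ≤ ‖t • x - θ‖ + ‖θ‖ := by simpa using norm_add_le (t • x - θ) θ
  rw [norm_smul, Real.norm_of_nonneg (by linarith)] at h1
  have h2 : ‖x‖ / 2 ≤ ‖t • x - θ‖ + ‖θ‖ := by nlinarith [norm_nonneg x]
  have h3 := pow_le_pow_left₀ (by positivity) h2 2
  nlinarith [sq_nonneg (‖t • x - θ‖ - ‖θ‖)]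

/-- A function growing at most quadratically at infinity and singular at most like `‖x‖⁻²` at the
origin is integrable against a Gaussian weight. -/
lemma integrable_mul_exp_neg_norm_sub_sq (hE : 2 < finrank ℝ E) (θ : E) {G : E → ℝ}
    (hG : Measurable G) {A B : ℝ}
    (hbd : ∀ x, x ≠ 0 → |G x| ≤ A * (‖x‖ ^ 2)⁻¹ + B * ‖x‖ ^ 2) :
    Integrable (fun x ↦ G x * Real.exp (-‖x - θ‖ ^ 2 / 2)) := by
  have : Nontrivial E := Module.nontrivial_of_finrank_pos (R := ℝ) (by omega)
  have hb : Integrable fun x : E ↦ Real.exp (‖θ‖ ^ 2 / 2) *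
      (|A| * ((‖x‖ ^ 2)⁻¹ * Real.exp (-(1 / 16) * ‖x‖ ^ 2)) +
        |B| * 32 * Real.exp (-(1 / 32) * ‖x‖ ^ 2)) :=
    (((integrable_inv_norm_sq_mul_exp (by norm_num) hE).const_mul _).add
      ((integrable_exp_neg_mul_norm_sq (by norm_num)).const_mul _)).const_mul _
  refine hb.mono' (by fun_prop) ?_
  filter_upwards [Measure.ae_ne volume (0 : E)] with x hx
  have h0 := exp_neg_norm_smul_sub_sq_le (t := 1) (by norm_num) θ x
  rw [one_smul] at h0
  -- Half of the exponent is spent on absorbing ‖x‖², through u + 1 ≤ exp u.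
  have h1 : ‖x‖ ^ 2 * Real.exp (-(1 / 16) * ‖x‖ ^ 2) ≤ 32 * Real.exp (-(1 / 32) * ‖x‖ ^ 2) := by
    have h2 := Real.add_one_le_exp ((1 / 32) * ‖x‖ ^ 2)
    have h3 : Real.exp (-(1 / 32) * ‖x‖ ^ 2) =
        Real.exp ((1 / 32) * ‖x‖ ^ 2) * Real.exp (-(1 / 16) * ‖x‖ ^ 2) := by
      rw [← Real.exp_add]; ring_nf
    rw [h3, ← mul_assoc]
    gcongr
    linarith
  rw [Real.norm_eq_abs, abs_mul, Real.abs_exp]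
  have hle : |G x| ≤ |A| * (‖x‖ ^ 2)⁻¹ + |B| * ‖x‖ ^ 2 := by
    refine (hbd x hx).trans ?_
    gcongr <;> exact le_abs_self _
  calc |G x| * Real.exp (-‖x - θ‖ ^ 2 / 2)
      ≤ (|A| * (‖x‖ ^ 2)⁻¹ + |B| * ‖x‖ ^ 2) *
        (Real.exp (‖θ‖ ^ 2 / 2) * Real.exp (-(1 / 16) * ‖x‖ ^ 2)) := by gcongr
    _ = Real.exp (‖θ‖ ^ 2 / 2) * (|A| * ((‖x‖ ^ 2)⁻¹ * Real.exp (-(1 / 16) * ‖x‖ ^ 2)) +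
        |B| * (‖x‖ ^ 2 * Real.exp (-(1 / 16) * ‖x‖ ^ 2))) := by ring
    _ ≤ _ := by rw [mul_assoc |B|]; gcongr

/-! ### Stein's identity by dilation -/

/-- The deviation in Stein's identity for the radial vector field `x ↦ k (‖x‖²) x`. -/
noncomputable def radialStein (k k' : ℝ → ℝ) (θ x : E) : ℝ :=
  finrank ℝ E * k (‖x‖ ^ 2) + 2 * ‖x‖ ^ 2 * k' (‖x‖ ^ 2) - k (‖x‖ ^ 2) * ⟪x - θ, x⟫

omit [FiniteDimensional ℝ E] [MeasurableSpace E] [BorelSpace E] in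
lemma hasDerivAt_radial_mul_exp {k k' : ℝ → ℝ} (hk : ∀ s, 0 < s → HasDerivAt k (k' s) s)
    (θ : E) {x : E} (hx : x ≠ 0) {t : ℝ} (ht : 0 < t) :
    HasDerivAt (fun t : ℝ ↦ k (‖t • x‖ ^ 2) * Real.exp (-‖t • x - θ‖ ^ 2 / 2))
      ((2 * t * ‖x‖ ^ 2 * k' (‖t • x‖ ^ 2) - k (‖t • x‖ ^ 2) * ⟪t • x - θ, x⟫) *
        Real.exp (-‖t • x - θ‖ ^ 2 / 2)) t := by
  have h1 : HasDerivAt (fun t : ℝ ↦ t • x) x t := by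
    simpa using (hasDerivAt_id t).smul_const x
  have h2 : HasDerivAt (fun t : ℝ ↦ ‖t • x‖ ^ 2) (2 * t * ‖x‖ ^ 2) t := by
    refine h1.norm_sq.congr_deriv ?_
    rw [real_inner_smul_left, real_inner_self_eq_norm_sq]; ring
  have h3 := (hk (‖t • x‖ ^ 2) (by have := smul_ne_zero ht.ne' hx; positivity)).comp t h2
  have h4 := (((h1.sub_const θ).norm_sq.neg).div_const 2).exp
  refine (h3.mul h4).congr_deriv ?_
  simp only [Function.comp, Pi.neg_apply]
  ring

/-- **Stein's identity** for radial vector fields, which may be singular at the origin. -/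
theorem integral_radialStein_mul_exp (hE : 2 < finrank ℝ E) (θ : E) {k k' : ℝ → ℝ} {C : ℝ}
    (hk : ∀ s, 0 < s → HasDerivAt k (k' s) s) (hkm : Measurable k) (hkm' : Measurable k')
    (hC : ∀ s, 0 < s → |k s| ≤ C / s) (hC' : ∀ s, 0 < s → |k' s| ≤ C / s ^ 2) :
    Integrable (fun x ↦ radialStein k k' θ x * Real.exp (-‖x - θ‖ ^ 2 / 2)) ∧
      ∫ x, radialStein k k' θ x * Real.exp (-‖x - θ‖ ^ 2 / 2) = 0 := by
  have : Nontrivial E := Module.nontrivial_of_finrank_pos (R := ℝ) (by omega)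
  have hC0 : 0 ≤ C := by simpa using (abs_nonneg _).trans (hC 1 one_pos)
  set F : ℝ → E → ℝ := fun t x ↦ k (‖t • x‖ ^ 2) * Real.exp (-‖t • x - θ‖ ^ 2 / 2) with hF
  set F' : ℝ → E → ℝ := fun t x ↦
    (2 * t * ‖x‖ ^ 2 * k' (‖t • x‖ ^ 2) - k (‖t • x‖ ^ 2) * ⟪t • x - θ, x⟫) *
      Real.exp (-‖t • x - θ‖ ^ 2 / 2) with hF'
  have hF1 : Integrable (F 1) := by
    have h := integrable_mul_exp_neg_norm_sub_sq hE θ (G := fun x ↦ k (‖x‖ ^ 2))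
      (by fun_prop) (A := C) (B := 0) fun x hx ↦ by
        have := hC (‖x‖ ^ 2) (by positivity)
        simpa [div_eq_mul_inv] using this
    simpa [hF] using h
  have hbound : Integrable fun x : E ↦ Real.exp (‖θ‖ ^ 2 / 2) *
      ((C * (16 + 4 * ‖θ‖ ^ 2)) * ((‖x‖ ^ 2)⁻¹ * Real.exp (-(1 / 16) * ‖x‖ ^ 2)) +
        (12 * C) * Real.exp (-(1 / 16) * ‖x‖ ^ 2)) :=
    (((integrable_inv_norm_sq_mul_exp (by norm_num) hE).const_mul _).add
      ((integrable_exp_neg_mul_norm_sq (by norm_num)).const_mul _)).const_mul _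
  -- The integral of F t is differentiated at t = 1 in two ways: under the integral sign here, by
  -- scaling in `hscale`. Equating the two is Stein's identity, with no boundary term at the origin
  -- to handle.
  obtain ⟨hint, hder⟩ := hasDerivAt_integral_of_dominated_loc_of_deriv_le (μ := volume)
    (F := F) (F' := F') (x₀ := (1 : ℝ)) (s := Set.Ioo (1 / 2) 2)
    (Ioo_mem_nhds (by norm_num) (by norm_num))
    (.of_forall fun t ↦ Measurable.aestronglyMeasurable (by fun_prop)) hF1
    (Measurable.aestronglyMeasurable (by fun_prop))
    (by
      filter_upwards [Measure.ae_ne volume (0 : E)] with x hx t ht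
      obtain ⟨ht1, ht2⟩ := ht
      have hS : 0 < ‖x‖ ^ 2 := by positivity
      have ht0 : 0 < t := by linarith
      have hts : ‖t • x‖ ^ 2 = t ^ 2 * ‖x‖ ^ 2 := by
        rw [norm_smul, mul_pow, Real.norm_eq_abs, sq_abs]
      have htS : 0 < t ^ 2 * ‖x‖ ^ 2 := by positivity
      have e0 := exp_neg_norm_smul_sub_sq_le ht1.le θ x
      have e1 : |2 * t * ‖x‖ ^ 2 * k' (t ^ 2 * ‖x‖ ^ 2)| ≤ 16 * C * (‖x‖ ^ 2)⁻¹ := by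
        rw [abs_mul, abs_of_pos (by positivity)]
        calc 2 * t * ‖x‖ ^ 2 * |k' (t ^ 2 * ‖x‖ ^ 2)|
            ≤ 2 * t * ‖x‖ ^ 2 * (C / (t ^ 2 * ‖x‖ ^ 2) ^ 2) := by
              gcongr; exact hC' _ htS
          _ = 2 * (t⁻¹) ^ 3 * C * (‖x‖ ^ 2)⁻¹ := by field_simp
          _ ≤ 2 * 2 ^ 3 * C * (‖x‖ ^ 2)⁻¹ := by
              gcongr
              rw [inv_le_comm₀ ht0 (by norm_num)]; linarith
          _ = _ := by ring
      have e2 : |k (t ^ 2 * ‖x‖ ^ 2)| ≤ 4 * C * (‖x‖ ^ 2)⁻¹ := by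
        calc |k (t ^ 2 * ‖x‖ ^ 2)| ≤ C / (t ^ 2 * ‖x‖ ^ 2) := hC _ htS
          _ = (t⁻¹) ^ 2 * C * (‖x‖ ^ 2)⁻¹ := by field_simp
          _ ≤ 2 ^ 2 * C * (‖x‖ ^ 2)⁻¹ := by
              gcongr
              rw [inv_le_comm₀ ht0 (by norm_num)]; linarith
          _ = _ := by ring
      have e3 : |⟪t • x - θ, x⟫| ≤ 3 * ‖x‖ ^ 2 + ‖θ‖ ^ 2 := by
        refine (abs_real_inner_le_norm _ _).trans ?_
        have h1 := norm_sub_le (t • x) θ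
        rw [norm_smul, Real.norm_of_nonneg ht0.le] at h1
        have h2 : ‖t • x - θ‖ ≤ 2 * ‖x‖ + ‖θ‖ := by nlinarith [norm_nonneg x]
        nlinarith [norm_nonneg x, sq_nonneg (‖x‖ - ‖θ‖), sq_nonneg ‖θ‖,
          mul_le_mul_of_nonneg_right h2 (norm_nonneg x)]
      simp only [hF', hts]
      rw [Real.norm_eq_abs, abs_mul, Real.abs_exp]
      calc _ ≤ (16 * C * (‖x‖ ^ 2)⁻¹ + 4 * C * (‖x‖ ^ 2)⁻¹ * (3 * ‖x‖ ^ 2 + ‖θ‖ ^ 2)) *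
            (Real.exp (‖θ‖ ^ 2 / 2) * Real.exp (-(1 / 16) * ‖x‖ ^ 2)) := by
              gcongr
              refine (abs_sub _ _).trans ?_
              rw [abs_mul (k _)]
              gcongr
        _ = _ := by field_simp; ring)
    hbound
    (by
      filter_upwards [Measure.ae_ne volume (0 : E)] with x hx t ht
      exact hasDerivAt_radial_mul_exp hk θ hx (by linarith [ht.1]))
  have hscale : HasDerivAt (fun t : ℝ ↦ ∫ x, F t x) (-(finrank ℝ E : ℝ) * ∫ x, F 1 x) 1 := by
    have h1 : HasDerivAt (fun t : ℝ ↦ (t ^ finrank ℝ E)⁻¹ * ∫ x, F 1 x)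
        (-(finrank ℝ E : ℝ) * ∫ x, F 1 x) 1 := by
      have := ((hasDerivAt_pow (finrank ℝ E) (1 : ℝ)).inv (by simp)).mul_const (∫ x, F 1 x)
      simpa using this
    refine h1.congr_of_eventuallyEq ?_
    filter_upwards [lt_mem_nhds (one_pos : (0 : ℝ) < 1)] with t ht
    have := Measure.integral_comp_smul_of_nonneg (volume : Measure E) (F 1) t (hR := ht.le)
    simpa [hF] using this
  have heq := hder.unique hscale
  have hfun : (fun x ↦ radialStein k k' θ x * Real.exp (-‖x - θ‖ ^ 2 / 2)) =
      fun x ↦ (finrank ℝ E : ℝ) * F 1 x + F' 1 x := by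
    ext x
    simp only [radialStein, hF, hF', one_smul]
    ring
  rw [hfun]
  refine ⟨(hF1.const_mul _).add hint, ?_⟩
  rw [integral_add (hF1.const_mul _) hint, integral_const_mul, heq]
  ring

/-! ### Reflection inequality and Gaussian density -/

/-- The Gaussian weight centred at `θ` puts more mass on the half space where `⟪θ, x⟫ > 0`. -/
lemma integral_mul_inner_mul_exp_nonneg (θ : E) {w : E → ℝ} (hw : ∀ x, 0 ≤ w x)
    (hwe : ∀ x, w (-x) = w x) :
    0 ≤ ∫ x, w x * ⟪θ, x⟫ * Real.exp (-‖x - θ‖ ^ 2 / 2) := by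
  set h : E → ℝ := fun x ↦ w x * ⟪θ, x⟫ * Real.exp (-‖x - θ‖ ^ 2 / 2) with hh
  by_cases hi : Integrable h
  swap
  · rw [integral_undef hi]
  have h1 : ∫ x, h (-x) = ∫ x, h x := integral_neg_eq_self h volume
  -- Pairing x with -x leaves ⟪θ, x⟫ times a difference of exponentials of the same sign.
  have h2 : 0 ≤ ∫ x, (h x + h (-x)) := by
    refine integral_nonneg fun x ↦ ?_
    simp only [hh, hwe, inner_neg_right, Pi.zero_apply]
    have e1 : ‖-x - θ‖ = ‖x + θ‖ := by rw [← norm_neg]; congr 1; abel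
    have e2 : ‖x - θ‖ ^ 2 = ‖x + θ‖ ^ 2 - 4 * ⟪θ, x⟫ := by
      rw [norm_sub_sq_real, norm_add_sq_real, real_inner_comm]; ring
    rw [e1, e2]
    have : 0 ≤ ⟪θ, x⟫ * (Real.exp (-(‖x + θ‖ ^ 2 - 4 * ⟪θ, x⟫) / 2) -
        Real.exp (-‖x + θ‖ ^ 2 / 2)) := by
      rcases le_total 0 ⟪θ, x⟫ with h | h
      · exact mul_nonneg h (sub_nonneg.2 (Real.exp_le_exp.2 (by linarith)))
      · exact mul_nonneg_of_nonpos_of_nonpos h (sub_nonpos.2 (Real.exp_le_exp.2 (by linarith)))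
    nlinarith [mul_nonneg (hw x) this]
  rw [integral_add hi hi.comp_neg, h1] at h2
  linarith

/-- The normalized Gaussian density centred at `θ`. -/
noncomputable def gaussianDensity (θ x : E) : ℝ :=
  (∫ y : E, Real.exp (-‖y‖ ^ 2 / 2))⁻¹ * Real.exp (-‖x - θ‖ ^ 2 / 2)

lemma integral_exp_neg_norm_sq_pos : 0 < ∫ y : E, Real.exp (-‖y‖ ^ 2 / 2) := by
  have h := GaussianFourier.integral_rexp_neg_mul_sq_norm (V := E) (b := 1 / 2) (by norm_num)
  have h2 : (fun y : E ↦ Real.exp (-‖y‖ ^ 2 / 2)) = fun y ↦ Real.exp (-(1 / 2) * ‖y‖ ^ 2) := by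
    ext y; ring_nf
  rw [h2, h]
  positivity

lemma gaussianDensity_nonneg (θ x : E) : 0 ≤ gaussianDensity θ x :=
  mul_nonneg (inv_nonneg.2 integral_exp_neg_norm_sq_pos.le) (Real.exp_pos _).le

@[fun_prop]
lemma measurable_gaussianDensity (θ : E) : Measurable (gaussianDensity θ) := by
  unfold gaussianDensity
  fun_prop

lemma integrable_gaussianDensity_zero : Integrable (gaussianDensity (0 : E)) := by
  have h := (integrable_exp_neg_mul_norm_sq (E := E) (b := 1 / 2) (by norm_num)).const_mul
    (∫ y : E, Real.exp (-‖y‖ ^ 2 / 2))⁻¹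
  refine h.congr (.of_forall fun x ↦ ?_)
  simp only [gaussianDensity, sub_zero]
  ring_nf

/-- The standard Gaussian measure has density proportional to `exp (-‖x‖² / 2)`. -/
lemma stdGaussian_eq_withDensity :
    stdGaussian E = volume.withDensity fun x ↦ ENNReal.ofReal (gaussianDensity 0 x) := by
  have : IsFiniteMeasure (volume.withDensity fun x : E ↦ ENNReal.ofReal (gaussianDensity 0 x)) :=
    isFiniteMeasure_withDensity_ofReal integrable_gaussianDensity_zero.2
  -- The Gaussian Fourier integral at frequency 0 gives the normalizing constant, at t the
  -- characteristic function.
  apply Measure.ext_of_charFun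
  ext t
  rw [charFun_stdGaussian, charFun_apply,
    integral_withDensity_eq_integral_toReal_smul (by fun_prop) (by simp)]
  have h0 := GaussianFourier.integral_cexp_neg_mul_sq_norm_add (V := E) (b := (1 / 2 : ℂ))
    (by norm_num) 0 0
  have h1 := GaussianFourier.integral_cexp_neg_mul_sq_norm_add (V := E) (b := (1 / 2 : ℂ))
    (by norm_num) Complex.I t
  have hZ : ((∫ y : E, Real.exp (-‖y‖ ^ 2 / 2) : ℝ) : ℂ) =
      (Real.pi / (1 / 2 : ℂ)) ^ (finrank ℝ E / 2 : ℂ) := by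
    rw [← integral_complex_ofReal]
    simp only [zero_mul, add_zero, ne_eq, OfNat.ofNat_ne_zero, not_false_eq_true, zero_pow,
      zero_div, Complex.exp_zero, mul_one] at h0
    rw [← h0]
    congr 1 with y
    push_cast
    ring_nf
  have hZ0 : ((∫ y : E, Real.exp (-‖y‖ ^ 2 / 2) : ℝ) : ℂ) ≠ 0 := by
    exact_mod_cast integral_exp_neg_norm_sq_pos.ne'
  have h2 : ∀ x : E, (ENNReal.ofReal (gaussianDensity 0 x)).toReal •
      Complex.exp (⟪x, t⟫ * Complex.I) =
      ((∫ y : E, Real.exp (-‖y‖ ^ 2 / 2) : ℝ) : ℂ)⁻¹ *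
        Complex.exp (-(1 / 2) * ‖x‖ ^ 2 + Complex.I * ⟪t, x⟫) := by
    intro x
    rw [ENNReal.toReal_ofReal (gaussianDensity_nonneg _ _), gaussianDensity, Complex.real_smul,
      Complex.exp_add, real_inner_comm, sub_zero]
    push_cast
    ring_nf
  simp_rw [h2]
  rw [integral_const_mul, h1, ← hZ, inv_mul_cancel_left₀ hZ0, Complex.I_sq]
  ring_nf

lemma map_const_add_stdGaussian (θ : E) :
    (stdGaussian E).map (θ + ·) =
      volume.withDensity fun x ↦ ENNReal.ofReal (gaussianDensity θ x) := by
  rw [stdGaussian_eq_withDensity]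
  ext s hs
  rw [Measure.map_apply (by fun_prop) hs, withDensity_apply _ (hs.preimage (by fun_prop)),
    withDensity_apply _ hs,
    ← (measurePreserving_add_left volume θ).setLIntegral_comp_preimage hs (by fun_prop)]
  simp [gaussianDensity]

end GaussianWeight

/-! ### Risks as integrals, and the comparison of losses -/

section Risk

open Module
open scoped RealInnerProductSpace

variable {p : ℕ}

lemma multivariateGaussian_one_eq_withDensity (θ : EuclideanSpace ℝ (Fin p)) :
    multivariateGaussian θ (1 : Matrix (Fin p) (Fin p) ℝ) =
      volume.withDensity fun x ↦ ENNReal.ofReal (gaussianDensity θ x) := by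
  rw [← map_const_add_stdGaussian]
  simp [multivariateGaussian]

lemma quadraticRisk_eq_ofReal_integral {θ : EuclideanSpace ℝ (Fin p)}
    {δ : EuclideanSpace ℝ (Fin p) → EuclideanSpace ℝ (Fin p)} (hδ : Measurable δ)
    (hi : Integrable fun x ↦ ‖δ x - θ‖ ^ 2 * Real.exp (-‖x - θ‖ ^ 2 / 2)) :
    quadraticRisk θ δ = ENNReal.ofReal
      ((∫ y : EuclideanSpace ℝ (Fin p), Real.exp (-‖y‖ ^ 2 / 2))⁻¹ *
        ∫ x, ‖δ x - θ‖ ^ 2 * Real.exp (-‖x - θ‖ ^ 2 / 2)) := by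
  have hpos := integral_exp_neg_norm_sq_pos (E := EuclideanSpace ℝ (Fin p))
  rw [quadraticRisk, multivariateGaussian_one_eq_withDensity,
    lintegral_withDensity_eq_lintegral_mul _ (by fun_prop) (by fun_prop), ← integral_const_mul,
    ofReal_integral_eq_lintegral_ofReal (hi.const_mul _)
      (.of_forall fun x ↦ mul_nonneg (inv_nonneg.2 hpos.le)
        (mul_nonneg (sq_nonneg _) (Real.exp_pos _).le))]
  refine lintegral_congr fun x ↦ ?_
  rw [Pi.mul_apply, ← ENNReal.ofReal_mul (gaussianDensity_nonneg _ _), gaussianDensity]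
  ring_nf

lemma norm_shrink_sub_sq (g : ℝ) (θ x : EuclideanSpace ℝ (Fin p)) :
    ‖(1 - g) • x - θ‖ ^ 2 = ‖x - θ‖ ^ 2 - 2 * g * ⟪x - θ, x⟫ + g ^ 2 * ‖x‖ ^ 2 := by
  have : (1 - g) • x - θ = (x - θ) - g • x := by module
  rw [this, norm_sub_sq_real, inner_smul_right, norm_smul, mul_pow, Real.norm_eq_abs, sq_abs]
  ring

lemma integrable_shrink_loss (hp : 2 < p) (θ : EuclideanSpace ℝ (Fin p)) {c : ℝ} {g : ℝ → ℝ}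
    (hg : Measurable g) (hgc : ∀ s, 0 < s → |g s| ≤ c / s) :
    Integrable fun x : EuclideanSpace ℝ (Fin p) ↦
      ‖(1 - g (‖x‖ ^ 2)) • x - θ‖ ^ 2 * Real.exp (-‖x - θ‖ ^ 2 / 2) := by
  refine integrable_mul_exp_neg_norm_sub_sq (by simpa using hp) θ (by fun_prop)
    (A := 2 * c ^ 2 + 4 * ‖θ‖ ^ 4 + 4) (B := 8) fun x hx ↦ ?_
  have hS : 0 < ‖x‖ ^ 2 := by positivity
  have e1 : ‖g (‖x‖ ^ 2) • x‖ ^ 2 ≤ c ^ 2 * (‖x‖ ^ 2)⁻¹ := by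
    rw [norm_smul, mul_pow, Real.norm_eq_abs]
    calc |g (‖x‖ ^ 2)| ^ 2 * ‖x‖ ^ 2 ≤ (c / ‖x‖ ^ 2) ^ 2 * ‖x‖ ^ 2 := by
          gcongr; exact hgc _ hS
      _ = _ := by field_simp
  have e2 : ‖(1 - g (‖x‖ ^ 2)) • x - θ‖ ^ 2 ≤
      2 * ‖g (‖x‖ ^ 2) • x‖ ^ 2 + 4 * ‖x‖ ^ 2 + 4 * ‖θ‖ ^ 2 := by
    have h1 : ‖(1 - g (‖x‖ ^ 2)) • x - θ‖ ≤ ‖g (‖x‖ ^ 2) • x‖ + (‖x‖ + ‖θ‖) := by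
      have : (1 - g (‖x‖ ^ 2)) • x - θ = (x - θ) - g (‖x‖ ^ 2) • x := by module
      rw [this]
      linarith [norm_sub_le (x - θ) (g (‖x‖ ^ 2) • x), norm_sub_le x θ]
    have h2 := pow_le_pow_left₀ (norm_nonneg _) h1 2
    nlinarith [sq_nonneg (‖g (‖x‖ ^ 2) • x‖ - (‖x‖ + ‖θ‖)), sq_nonneg (‖x‖ - ‖θ‖)]
  -- The required bound has no constant term, so ‖θ‖² is split between the singular and the
  -- quadratic term; hence the 8 = 4 + 4 in `B`.
  have e3 : ‖θ‖ ^ 2 ≤ ‖θ‖ ^ 4 * (‖x‖ ^ 2)⁻¹ + ‖x‖ ^ 2 := by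
    rw [← sub_nonneg]
    have : ‖θ‖ ^ 4 * (‖x‖ ^ 2)⁻¹ + ‖x‖ ^ 2 - ‖θ‖ ^ 2 =
        ((‖θ‖ ^ 2 - ‖x‖ ^ 2 / 2) ^ 2 + 3 / 4 * (‖x‖ ^ 2) ^ 2) * (‖x‖ ^ 2)⁻¹ := by
      field_simp; ring
    rw [this]; positivity
  rw [abs_of_nonneg (by positivity)]
  have : 0 < (‖x‖ ^ 2)⁻¹ := by positivity
  nlinarith

lemma abs_inv_mul_add_pow_le {a s : ℝ} (ha : 0 < a) (hs : 0 < s) (j : ℕ) :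
    |(s * (s + a) ^ j)⁻¹| ≤ (a ^ j)⁻¹ / s := by
  rw [abs_of_pos (by positivity), mul_inv, div_eq_mul_inv, mul_comm]
  gcongr
  linarith

lemma hasDerivAt_inv_mul_add_pow {a s : ℝ} (ha : 0 < a) (hs : 0 < s) (j : ℕ) :
    HasDerivAt (fun s ↦ (s * (s + a) ^ j)⁻¹)
      (-((s ^ 2 * (s + a) ^ j)⁻¹ + j * (s * (s + a) ^ (j + 1))⁻¹)) s := by
  have hsa : s + a ≠ 0 := by positivity
  have h : HasDerivAt (fun s ↦ s * (s + a) ^ j)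
      (1 * (s + a) ^ j + s * (j * (s + a) ^ (j - 1) * 1)) s :=
    (hasDerivAt_id' s).mul (((hasDerivAt_id' s).add_const a).pow j)
  refine (h.inv (by positivity)).congr_deriv ?_
  -- The exponent j - 1 truncates at j = 0.
  rcases j with _ | j
  · field_simp
    simp
  · simp only [Nat.add_sub_cancel]
    field_simp
    ring

lemma abs_deriv_inv_mul_add_pow_le {a s : ℝ} (ha : 0 < a) (hs : 0 < s) (j : ℕ) :
    |-((s ^ 2 * (s + a) ^ j)⁻¹ + j * (s * (s + a) ^ (j + 1))⁻¹)| ≤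
      (j + 1) * (a ^ j)⁻¹ / s ^ 2 := by
  rw [abs_neg, abs_of_pos (by positivity)]
  have h1 : (s ^ 2 * (s + a) ^ j)⁻¹ ≤ (s ^ 2 * a ^ j)⁻¹ := by
    gcongr; linarith
  have h2 : (s * (s + a) ^ (j + 1))⁻¹ ≤ (s ^ 2 * a ^ j)⁻¹ := by
    have : s * (s + a) ^ (j + 1) = s * (s + a) * (s + a) ^ j := by ring
    rw [this, sq]
    gcongr <;> linarith
  calc _ ≤ (s ^ 2 * a ^ j)⁻¹ + j * (s ^ 2 * a ^ j)⁻¹ := by gcongr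
    _ = _ := by rw [mul_inv]; ring

lemma integrable_jamesStein_loss (hp : 2 < p) (θ : EuclideanSpace ℝ (Fin p)) :
    Integrable fun x ↦ ‖jamesStein p x - θ‖ ^ 2 * Real.exp (-‖x - θ‖ ^ 2 / 2) :=
  integrable_shrink_loss hp θ (g := fun s ↦ ((p : ℝ) - 2) / s) (c := |(p : ℝ) - 2|) (by fun_prop)
    fun s hs ↦ by rw [abs_div, abs_of_pos hs]

lemma integrable_steinEstimator_loss (hp : 2 < p) {a : ℝ} (ha : 0 < a)
    (θ : EuclideanSpace ℝ (Fin p)) :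
    Integrable fun x ↦ ‖steinEstimator p a (p - 2) x - θ‖ ^ 2 * Real.exp (-‖x - θ‖ ^ 2 / 2) :=
  integrable_shrink_loss hp θ (g := fun s ↦ ((p : ℝ) - 2) / (s + a)) (c := |(p : ℝ) - 2|)
    (by fun_prop) fun s hs ↦ by
      rw [abs_div, abs_of_pos (by positivity : 0 < s + a)]
      gcongr
      linarith

/-- The Stein deviation of `x ↦ x / (‖x‖² (‖x‖² + a) ^ j)`. -/
noncomputable def steinDeviation (a : ℝ) (j : ℕ) (θ x : EuclideanSpace ℝ (Fin p)) : ℝ :=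
  radialStein (fun s ↦ (s * (s + a) ^ j)⁻¹)
    (fun s ↦ -((s ^ 2 * (s + a) ^ j)⁻¹ + j * (s * (s + a) ^ (j + 1))⁻¹)) θ x

lemma integral_steinDeviation (hp : 2 < p) {a : ℝ} (ha : 0 < a) (j : ℕ)
    (θ : EuclideanSpace ℝ (Fin p)) :
    Integrable (fun x ↦ steinDeviation a j θ x * Real.exp (-‖x - θ‖ ^ 2 / 2)) ∧
      ∫ x, steinDeviation a j θ x * Real.exp (-‖x - θ‖ ^ 2 / 2) = 0 := by
  refine integral_radialStein_mul_exp (by simpa using hp) θ (C := (j + 1) * (a ^ j)⁻¹)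
    (fun s hs ↦ hasDerivAt_inv_mul_add_pow ha hs j) (by fun_prop) (by fun_prop)
    (fun s hs ↦ (abs_inv_mul_add_pow_le ha hs j).trans ?_)
    (fun s hs ↦ abs_deriv_inv_mul_add_pow_le ha hs j)
  gcongr
  exact le_mul_of_one_le_left (by positivity) (by linarith [(Nat.cast_nonneg j : (0 : ℝ) ≤ j)])

/-- The difference of the losses, up to terms that integrate to zero, is the sum of a term with
nonnegative integral and a positive term. -/
lemma loss_sub_loss_eq {a : ℝ} (ha : 0 < a) (θ : EuclideanSpace ℝ (Fin p))
    {x : EuclideanSpace ℝ (Fin p)} (hx : x ≠ 0) :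
    ‖jamesStein p x - θ‖ ^ 2 - ‖steinEstimator p a (p - 2) x - θ‖ ^ 2 =
      (p - 2) * a * (2 * steinDeviation a 1 θ x - 4 * steinDeviation a 2 θ x +
        4 * ((‖x‖ ^ 2 * (‖x‖ ^ 2 + a) ^ 2)⁻¹ * ⟪θ, x⟫) +
        (‖x‖ ^ 2 * (‖x‖ ^ 2 + a) ^ 2)⁻¹ *
          (4 * p - 24 - (p - 2) * a + 16 * a / (‖x‖ ^ 2 + a))) := by
  have hS : 0 < ‖x‖ ^ 2 := by positivity
  rw [jamesStein, steinEstimator, norm_shrink_sub_sq, norm_shrink_sub_sq]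
  simp only [steinDeviation, radialStein, inner_sub_left, real_inner_self_eq_norm_sq,
    finrank_euclideanSpace, Fintype.card_fin]
  generalize ⟪θ, x⟫ = u
  generalize ‖x‖ ^ 2 = S at *
  have : S + a ≠ 0 := by positivity
  field_simp
  push_cast
  ring

theorem integral_steinEstimator_loss_lt {a : ℝ} (ha : 0 < a) (hp : 2 < p)
    (hpa : ((p : ℝ) - 2) * a ≤ 4 * p - 24) (θ : EuclideanSpace ℝ (Fin p)) :
    ∫ x, ‖steinEstimator p a (p - 2) x - θ‖ ^ 2 * Real.exp (-‖x - θ‖ ^ 2 / 2) <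
      ∫ x, ‖jamesStein p x - θ‖ ^ 2 * Real.exp (-‖x - θ‖ ^ 2 / 2) := by
  have hc : (0 : ℝ) < (p : ℝ) - 2 := by
    have : (2 : ℝ) < p := by exact_mod_cast hp
    linarith
  have : Nontrivial (EuclideanSpace ℝ (Fin p)) :=
    Module.nontrivial_of_finrank_pos (R := ℝ) (by simp; omega)
  set φ : EuclideanSpace ℝ (Fin p) → ℝ := fun x ↦ Real.exp (-‖x - θ‖ ^ 2 / 2)
  set w : EuclideanSpace ℝ (Fin p) → ℝ := fun x ↦ (‖x‖ ^ 2 * (‖x‖ ^ 2 + a) ^ 2)⁻¹ with hw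
  set r : EuclideanSpace ℝ (Fin p) → ℝ := fun x ↦
    w x * (4 * p - 24 - (p - 2) * a + 16 * a / (‖x‖ ^ 2 + a)) with hr
  obtain ⟨hi1, h1⟩ := integral_steinDeviation hp ha 1 θ
  obtain ⟨hi2, h2⟩ := integral_steinDeviation hp ha 2 θ
  have hJS := integrable_jamesStein_loss hp θ
  have hSt := integrable_steinEstimator_loss hp ha θ
  have hw0 : ∀ x, 0 ≤ w x := fun x ↦ by positivity
  have hwle : ∀ x, x ≠ 0 → w x ≤ (a ^ 2)⁻¹ * (‖x‖ ^ 2)⁻¹ := fun x hx ↦ by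
    have := (le_abs_self _).trans (abs_inv_mul_add_pow_le ha (s := ‖x‖ ^ 2) (by positivity) 2)
    rwa [div_eq_mul_inv] at this
  have hr0 : ∀ x, x ≠ 0 → 0 < r x := fun x hx ↦ by
    have : 0 < 16 * a / (‖x‖ ^ 2 + a) := by positivity
    exact mul_pos (by positivity) (by linarith)
  have hri : Integrable fun x ↦ r x * φ x := by
    refine integrable_mul_exp_neg_norm_sub_sq (by simpa using hp) θ (by fun_prop)
      (A := (a ^ 2)⁻¹ * (4 * p - 24 - (p - 2) * a + 16)) (B := 0) fun x hx ↦ ?_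
    rw [abs_of_pos (hr0 x hx), zero_mul, add_zero]
    have e : 16 * a / (‖x‖ ^ 2 + a) ≤ 16 := by
      rw [div_le_iff₀ (by positivity)]; nlinarith [sq_nonneg ‖x‖]
    have e' : 0 < 16 * a / (‖x‖ ^ 2 + a) := by positivity
    calc r x ≤ ((a ^ 2)⁻¹ * (‖x‖ ^ 2)⁻¹) * (4 * p - 24 - (p - 2) * a + 16) :=
          mul_le_mul (hwle x hx) (by linarith) (by linarith) (by positivity)
      _ = _ := by ring
  have hqi : Integrable fun x ↦ w x * ⟪θ, x⟫ * φ x := by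
    refine integrable_mul_exp_neg_norm_sub_sq (by simpa using hp) θ (by fun_prop)
      (A := (a ^ 2)⁻¹ * (1 + ‖θ‖ ^ 2)) (B := (a ^ 2)⁻¹) fun x hx ↦ ?_
    have hS : 0 < ‖x‖ ^ 2 := by positivity
    -- The fourth power makes only ‖x‖⁻² and ‖x‖² appear after multiplication by the bound on w.
    have e : |⟪θ, x⟫| ≤ ‖θ‖ ^ 2 + 1 + (‖x‖ ^ 2) ^ 2 := by
      refine (abs_real_inner_le_norm _ _).trans ?_
      nlinarith [sq_nonneg (‖θ‖ - ‖x‖), sq_nonneg (‖x‖ ^ 2 - 1), sq_nonneg ‖θ‖]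
    rw [abs_mul, abs_of_nonneg (hw0 x)]
    calc w x * |⟪θ, x⟫| ≤ ((a ^ 2)⁻¹ * (‖x‖ ^ 2)⁻¹) * (‖θ‖ ^ 2 + 1 + (‖x‖ ^ 2) ^ 2) := by
          gcongr; exact hwle x hx
      _ = _ := by field_simp; ring
  have hrpos : 0 < ∫ x, r x * φ x := by
    have hae : ∀ᵐ x : EuclideanSpace ℝ (Fin p), 0 < r x * φ x := by
      filter_upwards [Measure.ae_ne volume (0 : EuclideanSpace ℝ (Fin p))] with x hx
      exact mul_pos (hr0 x hx) (Real.exp_pos _)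
    rw [integral_pos_iff_support_of_nonneg_ae (hae.mono fun x hx ↦ hx.le) hri]
    have : Function.support (fun x ↦ r x * φ x) =ᵐ[volume] Set.univ := by
      filter_upwards [hae] with x hx
      exact eq_true (ne_of_gt hx)
    rw [measure_congr this]
    exact Measure.measure_univ_pos.2 (NeZero.ne _)
  have hq := integral_mul_inner_mul_exp_nonneg θ hw0 (by simp [hw])
  have key : ∫ x, (‖jamesStein p x - θ‖ ^ 2 * φ x - ‖steinEstimator p a (p - 2) x - θ‖ ^ 2 * φ x)
      = ∫ x, (p - 2) * a * (2 * (steinDeviation a 1 θ x * φ x) -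
        4 * (steinDeviation a 2 θ x * φ x) + 4 * (w x * ⟪θ, x⟫ * φ x) + r x * φ x) := by
    refine integral_congr_ae ?_
    filter_upwards [Measure.ae_ne volume (0 : EuclideanSpace ℝ (Fin p))] with x hx
    rw [← sub_mul, loss_sub_loss_eq ha θ hx]
    simp only [hr, hw]
    ring
  have i1 : Integrable fun x ↦ 2 * (steinDeviation a 1 θ x * φ x) := hi1.const_mul 2
  have i2 : Integrable fun x ↦ 4 * (steinDeviation a 2 θ x * φ x) := hi2.const_mul 4
  have i3 : Integrable fun x ↦ 4 * (w x * ⟪θ, x⟫ * φ x) := hqi.const_mul 4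
  have i12 : Integrable fun x ↦ 2 * (steinDeviation a 1 θ x * φ x) -
      4 * (steinDeviation a 2 θ x * φ x) := i1.sub i2
  have i123 : Integrable fun x ↦ 2 * (steinDeviation a 1 θ x * φ x) -
      4 * (steinDeviation a 2 θ x * φ x) + 4 * (w x * ⟪θ, x⟫ * φ x) := i12.add i3
  rw [integral_sub hJS hSt, integral_const_mul, integral_add i123 hri, integral_add i12 i3,
    integral_sub i1 i2, integral_const_mul, integral_const_mul, integral_const_mul, h1, h2] at key
  have : 0 < ((p : ℝ) - 2) * a * (2 * 0 - 4 * 0 + 4 * (∫ x, w x * ⟪θ, x⟫ * φ x) +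
      ∫ x, r x * φ x) := mul_pos (by positivity) (by linarith)
  linarith

end Risk

theorem mainTheorem5 (a : ℝ) (ha0 : 0 < a) (ha4 : a < 4) (p : ℕ)
    (hp : 2 * (12 - a) / (4 - a) ≤ (p : ℝ)) :
    Dominates (steinEstimator p a ((p : ℝ) - 2)) (jamesStein p) := by
  -- Cleared of its denominator, the hypothesis reads (p-2)a ≤ 4p - 24.
  rw [div_le_iff₀ (by linarith)] at hp
  have hp6 : (2 : ℝ) < p := by nlinarith
  have hp2 : 2 < p := by exact_mod_cast hp6
  have hlt : ∀ θ, quadraticRisk θ (steinEstimator p a ((p : ℝ) - 2)) <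
      quadraticRisk θ (jamesStein p) := fun θ ↦ by
    have hi := integral_steinEstimator_loss_lt ha0 hp2 (by linarith) θ
    have hZ := integral_exp_neg_norm_sq_pos (E := EuclideanSpace ℝ (Fin p))
    rw [quadraticRisk_eq_ofReal_integral (by unfold steinEstimator; fun_prop)
        (integrable_steinEstimator_loss hp2 ha0 θ),
      quadraticRisk_eq_ofReal_integral (by unfold jamesStein; fun_prop)
        (integrable_jamesStein_loss hp2 θ)]
    refine (ENNReal.ofReal_lt_ofReal_iff_of_nonneg ?_).2 ?_
    · exact mul_nonneg (inv_nonneg.2 hZ.le)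
        (integral_nonneg fun x ↦ mul_nonneg (sq_nonneg _) (Real.exp_pos _).le)
    · gcongr
  exact ⟨fun θ ↦ (hlt θ).le, 0, hlt 0⟩
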